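/- Let $\overline{\mathbb F}_q$ be an algebraic closure of a finite field $\mathbb F_q$, let $m\ge 0$, and let $X=\mathrm{Proj}(\overline{\mathbb F}_q[x_0,\dots,x_m]/I)\subseteq\mathbb P^m(\overline{\mathbb F}_q)$ be a nonempty projective subscheme, where $I$ is a homogeneous ideal. Let $I(X)$ be the saturation of $I$, that is, the ideal of all $f$ for which there is an $n\ge 0$ with $x_i^n f\in I$ for all $i$, and let $S_t(X)$ be the degree $t$ part of $S(X)=\overline{\mathbb F}_q[x_0,\dots,x_m]/I(X)$. Let $k=\dim(X)$ be the dimension of $X$ as a topological space and let $c=\deg(X)$ be its degree, that is, $k!$ times the leading coefficient of the Hilbert polynomial of $X$ (the polynomial in $t$ that equals $\dim_{\overline{\mathbb F}_q} S_t(X)$ for all large $t$). Then, for every integer $t\ge 0$: 1. if $t\le c-1$, then $\dim_{\overline{\mathbb F}_q} S_t(X)\ge\binom{t+k+1}{k+1}$; 2. if $t\ge c$, then $\dim_{\overline{\mathbb F}_q} S_t(X)\ge\binom{t+k+1}{k+1}-\binom{t+k+1-c}{k+1}$. -/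

import Mathlib

attribute [local instance] MvPolynomial.gradedAlgebra

/-- A projective subscheme `X = Proj (K[x_0, …, x_m] / I)` of `ℙ^m` over `K`, given by a homogeneous
ideal `I` of `K[x_0, …, x_m]` for the standard grading. Different `I` may give the same `X`; all the
notions below depend on `I` only through its saturation. -/
abbrev ProjSubscheme (K : Type*) [Field K] (m : ℕ) : Type _ :=
  HomogeneousIdeal (MvPolynomial.homogeneousSubmodule (Fin (m + 1)) K)

namespace ProjSubscheme

variable {K : Type*} [Field K] {m : ℕ}

/-- The underlying space of `X`, as the closed subset `V(I)` of `ℙ^m = Proj K[x_0, …, x_m]`. -/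
def support (X : ProjSubscheme K m) :
    Set (ProjectiveSpectrum (MvPolynomial.homogeneousSubmodule (Fin (m + 1)) K)) :=
  ProjectiveSpectrum.zeroLocus _ (X : Set (MvPolynomial (Fin (m + 1)) K))

/-- The dimension of `X`: the Krull dimension of its underlying topological space
(it is `⊥` exactly when `X` is empty). -/
noncomputable def dim (X : ProjSubscheme K m) : WithBot ℕ∞ :=
  topologicalKrullDim X.support

/-- The ideal `I(X)`: the saturation of `I`, that is, the set of all `f` such that for some `n`
each of `x_0 ^ n * f, …, x_m ^ n * f` lies in `I`. -/
def satIdeal (X : ProjSubscheme K m) : Ideal (MvPolynomial (Fin (m + 1)) K) where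
  carrier := {f | ∃ n : ℕ, ∀ i, MvPolynomial.X i ^ n * f ∈ X.toIdeal}
  zero_mem' := ⟨0, fun i => by simp⟩
  add_mem' := by
    rintro f g ⟨a, ha⟩ ⟨b, hb⟩
    refine ⟨a + b, fun i => ?_⟩
    have h1 := X.toIdeal.mul_mem_left (MvPolynomial.X i ^ b) (ha i)
    have h2 := X.toIdeal.mul_mem_left (MvPolynomial.X i ^ a) (hb i)
    have h3 := X.toIdeal.add_mem h1 h2
    convert h3 using 1
    ring
  smul_mem' := by
    rintro r f ⟨a, ha⟩
    refine ⟨a, fun i => ?_⟩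
    have h1 := X.toIdeal.mul_mem_left r (ha i)
    convert h1 using 1
    simp only [smul_eq_mul]
    ring

/-- The degree `t` part `S_t(X)` of the homogeneous coordinate ring `S(X) = K[x_0, …, x_m] / I(X)`:
the classes of the homogeneous polynomials of degree `t`. -/
noncomputable def coordPart (X : ProjSubscheme K m) (t : ℕ) :
    Submodule K (MvPolynomial (Fin (m + 1)) K ⧸ X.satIdeal) :=
  (MvPolynomial.homogeneousSubmodule (Fin (m + 1)) K t).map
    (Ideal.Quotient.mkₐ K X.satIdeal).toLinearMap

/-- The Hilbert function `t ↦ dim_K S_t(X)`. -/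
noncomputable def hilbertFun (X : ProjSubscheme K m) (t : ℕ) : ℕ :=
  Module.finrank K (X.coordPart t)

instance coordPart_finite (X : ProjSubscheme K m) (t : ℕ) : Module.Finite K (X.coordPart t) := by
  have hle : MvPolynomial.homogeneousSubmodule (Fin (m + 1)) K t ≤
      MvPolynomial.restrictTotalDegree (Fin (m + 1)) K t := by
    intro p hp
    rw [MvPolynomial.mem_restrictTotalDegree]
    exact MvPolynomial.IsHomogeneous.totalDegree_le hp
  have : Module.Finite K (MvPolynomial.homogeneousSubmodule (Fin (m + 1)) K t) :=
    Submodule.finiteDimensional_of_le hle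
  unfold coordPart
  infer_instance

/-- `P` is the Hilbert polynomial of `X`: it agrees with the Hilbert function for all large `t`. -/
def IsHilbertPolynomial (X : ProjSubscheme K m) (P : Polynomial ℚ) : Prop :=
  ∀ᶠ t : ℕ in Filter.atTop, (X.hilbertFun t : ℚ) = P.eval (t : ℚ)

theorem IsHilbertPolynomial.unique {X : ProjSubscheme K m} {P Q : Polynomial ℚ}
    (hP : X.IsHilbertPolynomial P) (hQ : X.IsHilbertPolynomial Q) : P = Q := by
  obtain ⟨N, hN⟩ := Filter.eventually_atTop.1 (hP.and hQ)
  refine Polynomial.eq_of_infinite_eval_eq P Q ?_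
  refine Set.Infinite.mono ?_
    ((Set.Ici_infinite N).image (f := fun n : ℕ => (n : ℚ)) Nat.cast_injective.injOn)
  rintro _ ⟨n, hn, rfl⟩
  exact (hN n hn).1.symm.trans (hN n hn).2

open Classical in
/-- The Hilbert polynomial of `X`. (It always exists, by the theorem of Hilbert; the value `0` of the
other branch is only a default.) -/
noncomputable def hilbertPolynomial (X : ProjSubscheme K m) : Polynomial ℚ :=
  if h : ∃ P : Polynomial ℚ, X.IsHilbertPolynomial P then h.choose else 0

theorem IsHilbertPolynomial.eq {X : ProjSubscheme K m} {P : Polynomial ℚ}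
    (hP : X.IsHilbertPolynomial P) : X.hilbertPolynomial = P := by
  have h : ∃ P : Polynomial ℚ, X.IsHilbertPolynomial P := ⟨P, hP⟩
  rw [hilbertPolynomial, dif_pos h]
  exact h.choose_spec.unique hP

/-- The degree of `X`: if the Hilbert polynomial of `X` has degree `k` (which is the dimension of a
nonempty `X`), then `deg X` is `k!` times its leading coefficient. -/
noncomputable def deg (X : ProjSubscheme K m) : ℚ :=
  (X.hilbertPolynomial.natDegree.factorial : ℚ) * X.hilbertPolynomial.leadingCoeff

end ProjSubscheme

/-!
The bound `C(t+k+1, k+1) - C(t+k+1-c, k+1)` is the Hilbert function of a hypersurface of degree `c`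
in `ℙ^(k+1)`, and it is the sum over `s ≤ t` of the same bounds for `k - 1` in degree `s`. So it can
be proved by cutting with hyperplanes. Since `I(X)` is saturated and `K` is infinite, some linear
form `l` is a nonzerodivisor on `S(X)` (`MvPolynomial.exists_linear_form_regular`). The Hilbert
function of `S(X) / (l)` is then the first difference of that of `S(X)`
(`ProjSubscheme.exists_hyperplane_section`); it is at least the Hilbert function of the hyperplane
section, to which it is equal in large degrees. The induction in
`ProjSubscheme.choose_le_hilbertFun_add` runs on the number `d` of differences after which the
Hilbert function is eventually the constant `c`. It ends at `d = 0`, where the first difference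
belongs to a standard graded algebra and cannot become positive again after it has vanished. The
same cutting, with Noetherian induction, shows that the Hilbert polynomial exists
(`ProjSubscheme.exists_isHilbertPolynomial`).

For the Hilbert polynomial `P` of degree `d`, the `d`-th difference is `d!` times the leading
coefficient, which is `c`. This gives the bound with `d` in place of `k = dim X`. The bound is
monotone in `k`, so `k ≤ d` is enough (`ProjSubscheme.IsHilbertPolynomial.le_natDegree`). That
follows from a chain of homogeneous primes `p_0 ⊂ ⋯ ⊂ p_k` belonging to a chain of irreducible
closed subsets of `X`: a form in `p_{i+1}` but not in `p_i` is a nonzerodivisor modulo `p_i`, so the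
Hilbert function of `p_i` grows faster than that of `p_{i+1}` by one order
(`MvPolynomial.HasGrowth.succ`).
-/

section

open MvPolynomial

/-! ### Hilbert functions of graded quotients -/

namespace MvPolynomial

variable {σ K : Type*} [Field K]

/-- The degree `t` part of `K[x] / J`, as the space of classes of the forms of degree `t`. This
makes sense for every ideal `J`; it is a grading only when `J` is homogeneous. -/
noncomputable def gradedPart (J : Ideal (MvPolynomial σ K)) (t : ℕ) :
    Submodule K (MvPolynomial σ K ⧸ J) :=
  (homogeneousSubmodule σ K t).map (Ideal.Quotient.mkₐ K J).toLinearMap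

/-- The Hilbert function of `K[x] / J`. -/
noncomputable def hilb (J : Ideal (MvPolynomial σ K)) (t : ℕ) : ℕ :=
  Module.finrank K (gradedPart J t)

theorem mem_gradedPart {J : Ideal (MvPolynomial σ K)} {t : ℕ} {x : MvPolynomial σ K ⧸ J} :
    x ∈ gradedPart J t ↔ ∃ f : MvPolynomial σ K, f.IsHomogeneous t ∧ Ideal.Quotient.mk J f = x :=
  Iff.rfl

theorem mk_mem_gradedPart (J : Ideal (MvPolynomial σ K)) {t : ℕ} {f : MvPolynomial σ K}
    (hf : f.IsHomogeneous t) : Ideal.Quotient.mk J f ∈ gradedPart J t :=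
  ⟨f, hf, rfl⟩

theorem gradedPart_map_factor {J J' : Ideal (MvPolynomial σ K)} (h : J ≤ J') (t : ℕ) :
    (gradedPart J t).map (Ideal.Quotient.factorₐ K h).toLinearMap = gradedPart J' t := by
  rw [gradedPart, ← Submodule.map_comp]
  rfl

theorem homogeneousComponent_mul_of_isHomogeneous {f g : MvPolynomial σ K} {e : ℕ}
    (hf : f.IsHomogeneous e) (t : ℕ) :
    homogeneousComponent (t + e) (f * g) = f * homogeneousComponent t g := by
  conv_lhs => rw [← sum_homogeneousComponent g, Finset.mul_sum, map_sum]
  have h : ∀ i, homogeneousComponent (t + e) (f * homogeneousComponent i g) =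
      if i = t then f * homogeneousComponent i g else 0 := fun i => by
    rw [homogeneousComponent_of_mem (hf.mul (homogeneousComponent_isHomogeneous i g))]
    exact if_congr (by omega) rfl rfl
  simp_rw [h]
  rw [Finset.sum_ite_eq']
  split_ifs with ht
  · rfl
  · rw [homogeneousComponent_eq_zero, mul_zero]
    simpa using ht

variable [Finite σ]

instance gradedPart_finite (J : Ideal (MvPolynomial σ K)) (t : ℕ) :
    Module.Finite K (gradedPart J t) := by
  have : Module.Finite K (homogeneousSubmodule σ K t) :=
    Module.Finite.iff_fg.2 (homogeneousSubmodule_fg σ K t)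
  unfold gradedPart
  infer_instance

/-- Rank-nullity for the surjection `(K[x] / J)_t → (K[x] / J')_t`. -/
theorem hilb_add_finrank_ker {J J' : Ideal (MvPolynomial σ K)} (h : J ≤ J') (t : ℕ) :
    hilb J' t + Module.finrank K
      (((Ideal.Quotient.factorₐ K h).toLinearMap.domRestrict (gradedPart J t)).ker) =
      hilb J t := by
  rw [hilb, hilb, ← gradedPart_map_factor h t, ← LinearMap.range_domRestrict]
  exact LinearMap.finrank_range_add_finrank_ker _

theorem hilb_anti {J J' : Ideal (MvPolynomial σ K)} (h : J ≤ J') (t : ℕ) :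
    hilb J' t ≤ hilb J t :=
  (hilb_add_finrank_ker h t).symm ▸ Nat.le_add_right _ _

theorem hilb_eq_of_forall_mem {J J' : Ideal (MvPolynomial σ K)} (h : J ≤ J') (t : ℕ)
    (ht : ∀ f : MvPolynomial σ K, f.IsHomogeneous t → f ∈ J' → f ∈ J) : hilb J' t = hilb J t := by
  rw [← hilb_add_finrank_ker h t, left_eq_add, Submodule.finrank_eq_zero, LinearMap.ker_eq_bot']
  rintro ⟨x, hx⟩ h0
  obtain ⟨f, hf, rfl⟩ := mem_gradedPart.1 hx
  have h1 : Ideal.Quotient.mk J' f = 0 := h0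
  rw [Ideal.Quotient.eq_zero_iff_mem] at h1
  exact Subtype.ext (Ideal.Quotient.eq_zero_iff_mem.2 (ht f hf h1))

/-- For a form `f` of degree `e` which is a nonzerodivisor modulo the homogeneous ideal `J`, the
sequence `0 → (K[x] / J)_t → (K[x] / J)_{t+e} → (K[x] / (J, f))_{t+e} → 0`, whose first map is
multiplication by `f`, is exact. -/
theorem hilb_sup_span_add {J : Ideal (MvPolynomial σ K)}
    (hJ : J.IsHomogeneous (homogeneousSubmodule σ K)) {f : MvPolynomial σ K} {e : ℕ}
    (hf : f.IsHomogeneous e) (hreg : ∀ g, f * g ∈ J → g ∈ J) (t : ℕ) :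
    hilb (J ⊔ Ideal.span {f}) (t + e) + hilb J t = hilb J (t + e) := by
  have hle : J ≤ J ⊔ Ideal.span {f} := le_sup_left
  let μ : gradedPart J t →ₗ[K] gradedPart J (t + e) :=
    (LinearMap.mulLeft K (Ideal.Quotient.mk J f)).restrict (by
      intro x hx
      obtain ⟨g, hg, rfl⟩ := mem_gradedPart.1 hx
      rw [LinearMap.mulLeft_apply, ← map_mul, add_comm t e]
      exact mk_mem_gradedPart J (hf.mul hg))
  have hμ : Function.Injective μ := by
    rw [← LinearMap.ker_eq_bot, LinearMap.ker_eq_bot']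
    rintro ⟨x, hx⟩ h0
    obtain ⟨g, hg, rfl⟩ := mem_gradedPart.1 hx
    have h1 : Ideal.Quotient.mk J (f * g) = 0 := by
      rw [map_mul]; exact congrArg Subtype.val h0
    rw [Ideal.Quotient.eq_zero_iff_mem] at h1
    exact Subtype.ext (Ideal.Quotient.eq_zero_iff_mem.2 (hreg g h1))
  have hker : ((Ideal.Quotient.factorₐ K hle).toLinearMap.domRestrict
      (gradedPart J (t + e))).ker = μ.range := by
    ext ⟨x, hx⟩
    obtain ⟨p, hp, rfl⟩ := mem_gradedPart.1 hx
    constructor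
    · intro h0
      have h1 : Ideal.Quotient.mk (J ⊔ Ideal.span {f}) p = 0 := h0
      rw [Ideal.Quotient.eq_zero_iff_mem] at h1
      obtain ⟨a, ha, b, hb, rfl⟩ := Submodule.mem_sup.1 h1
      obtain ⟨g, rfl⟩ := Ideal.mem_span_singleton'.1 hb
      refine ⟨⟨_, mk_mem_gradedPart J (homogeneousComponent_isHomogeneous t g)⟩, ?_⟩
      refine Subtype.ext ?_
      change Ideal.Quotient.mk J f * Ideal.Quotient.mk J _ = Ideal.Quotient.mk J _
      rw [← map_mul, eq_comm, Ideal.Quotient.mk_eq_mk_iff_sub_mem]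
      have h2 := homogeneousComponent_mem_of_mem hJ ha (t + e)
      rw [← homogeneousComponent_mul_of_isHomogeneous hf,
        ← homogeneousComponent_eq_self hp, map_add, mul_comm f g, add_sub_cancel_right]
      exact h2
    · rintro ⟨⟨y, hy⟩, hxy⟩
      obtain ⟨g, hg, rfl⟩ := mem_gradedPart.1 hy
      have h1 : Ideal.Quotient.mk J (f * g) = Ideal.Quotient.mk J p := by
        rw [map_mul]; exact congrArg Subtype.val hxy
      change Ideal.Quotient.mk (J ⊔ Ideal.span {f}) p = 0
      rw [Ideal.Quotient.eq_zero_iff_mem]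
      rw [eq_comm, Ideal.Quotient.mk_eq_mk_iff_sub_mem] at h1
      have h2 : f * g ∈ J ⊔ Ideal.span {f} :=
        Ideal.mem_sup_right (Ideal.mul_mem_right _ _ (Ideal.mem_span_singleton_self f))
      simpa using Ideal.add_mem _ (hle h1) h2
  rw [← hilb_add_finrank_ker hle (t + e), hker, LinearMap.finrank_range_of_inj hμ]
  rfl

theorem hilb_eq_zero_iff {J : Ideal (MvPolynomial σ K)} {t : ℕ} :
    hilb J t = 0 ↔ ∀ f : MvPolynomial σ K, f.IsHomogeneous t → f ∈ J := by
  rw [hilb, Submodule.finrank_eq_zero, Submodule.eq_bot_iff]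
  constructor
  · exact fun h f hf => Ideal.Quotient.eq_zero_iff_mem.1 (h _ (mk_mem_gradedPart J hf))
  · rintro h x hx
    obtain ⟨f, hf, rfl⟩ := mem_gradedPart.1 hx
    exact Ideal.Quotient.eq_zero_iff_mem.2 (h f hf)

theorem hilb_succ_eq_zero {J : Ideal (MvPolynomial σ K)} {t : ℕ} (h : hilb J t = 0) :
    hilb J (t + 1) = 0 := by
  rw [hilb_eq_zero_iff] at h ⊢
  intro f hf
  rw [f.as_sum]
  refine Ideal.sum_mem _ fun d hd => ?_
  have hdeg : d.degree = t + 1 := by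
    by_contra hne
    exact mem_support_iff.1 hd (hf.coeff_eq_zero hne)
  obtain ⟨i, hi⟩ : ∃ i, d i ≠ 0 := by
    by_contra! hall
    rw [show d = 0 from Finsupp.ext hall] at hdeg
    simp at hdeg
  have hd' : d = Finsupp.single i 1 + (d - Finsupp.single i 1) :=
    (add_tsub_cancel_of_le (Finsupp.single_le_iff.2 (Nat.one_le_iff_ne_zero.2 hi))).symm
  have hdeg' : (d - Finsupp.single i 1).degree = t := by
    have := congrArg Finsupp.degree hd'
    rw [map_add, Finsupp.degree_single] at this
    omega
  rw [hd', ← one_mul (coeff _ f), ← monomial_mul]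
  exact Ideal.mul_mem_left _ _ (h _ (isHomogeneous_monomial _ hdeg'))

theorem hilb_eq_zero_of_le {J : Ideal (MvPolynomial σ K)} {s t : ℕ} (h : hilb J s = 0)
    (hst : s ≤ t) : hilb J t = 0 := by
  induction t, hst using Nat.le_induction with
  | base => exact h
  | succ t _ ih => exact hilb_succ_eq_zero ih

end MvPolynomial

/-! ### Regular linear forms -/

namespace MvPolynomial

variable {σ K : Type*} [Field K]

/-- By the pigeonhole principle each monomial of `g` is divisible by some `X i ^ n`. -/
theorem mul_mem_of_X_pow_mul_mem [Fintype σ] {I : Ideal (MvPolynomial σ K)} {f : MvPolynomial σ K}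
    {n : ℕ} (hf : ∀ i, X i ^ n * f ∈ I) {t : ℕ} (ht : Fintype.card σ * n < t)
    {g : MvPolynomial σ K} (hg : g.IsHomogeneous t) : g * f ∈ I := by
  rw [g.as_sum, Finset.sum_mul]
  refine Ideal.sum_mem _ fun d hd => ?_
  have hdeg : d.degree = t := by
    by_contra hne
    exact mem_support_iff.1 hd (hg.coeff_eq_zero hne)
  obtain ⟨i, hi⟩ : ∃ i, n ≤ d i := by
    by_contra! hall
    have : d.degree ≤ Fintype.card σ * n := by
      rw [Finsupp.degree_eq_sum]
      exact (Finset.sum_le_card_nsmul _ _ n fun i _ => (hall i).le).trans_eq (by simp)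
    omega
  have hd' : d = (d - Finsupp.single i n) + Finsupp.single i n :=
    (tsub_add_cancel_of_le (Finsupp.single_le_iff.2 hi)).symm
  rw [hd', ← mul_one (coeff _ g), ← monomial_mul, ← X_pow_eq_monomial, mul_assoc]
  exact Ideal.mul_mem_left _ _ (hf i)

variable [Finite σ]

/-- The associated primes of `K[x] / J` are finitely many, and none contains all variables, since an
element killed by all variables is zero. Hence over an infinite field some linear form avoids all of
them. -/
theorem exists_linear_form_regular [Infinite K] (J : Ideal (MvPolynomial σ K))
    (hsat : ∀ f, (∀ i, X i * f ∈ J) → f ∈ J) :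
    ∃ l : MvPolynomial σ K, l.IsHomogeneous 1 ∧ ∀ g, l * g ∈ J → g ∈ J := by
  classical
  let R := MvPolynomial σ K
  have hfin : (associatedPrimes R (R ⧸ J)).Finite := associatedPrimes.finite R (R ⧸ J)
  let V := homogeneousSubmodule σ K 1
  let tr : Ideal R → Subspace K V := fun p => (p.restrictScalars K).comap V.subtype
  have htop : ⊤ ∉ hfin.toFinset.image tr := by
    intro hmem
    obtain ⟨p, hp, hpt⟩ := Finset.mem_image.1 hmem
    rw [Set.Finite.mem_toFinset, AssociatedPrimes.mem_iff, isAssociatedPrime_iff] at hp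
    obtain ⟨hprime, x, hx⟩ := hp
    obtain ⟨f, rfl⟩ := Ideal.Quotient.mk_surjective x
    have hX : ∀ i, X i * f ∈ J := fun i => by
      have h1 : (⟨X i, isHomogeneous_X K i⟩ : V) ∈ tr p := hpt ▸ Submodule.mem_top
      have h2 : (X i : R) ∈ p := h1
      rw [hx, Submodule.mem_colon_singleton, Submodule.mem_bot] at h2
      rw [← Ideal.Quotient.eq_zero_iff_mem]
      exact h2
    have hf : Ideal.Quotient.mk J f = 0 := Ideal.Quotient.eq_zero_iff_mem.2 (hsat f hX)
    refine hprime.ne_top ((Ideal.eq_top_iff_one _).2 ?_)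
    rw [hx, Submodule.mem_colon_singleton, Submodule.mem_bot, hf, smul_zero]
  have hne := Subspace.biUnion_ne_univ_of_top_notMem htop
  obtain ⟨l, hl⟩ := (Set.ne_univ_iff_exists_notMem _).1 hne
  refine ⟨l, l.2, fun g hg => ?_⟩
  by_contra hgJ
  have hzd : (l : R) ∈ {r : R | ∃ x : R ⧸ J, x ≠ 0 ∧ r • x = 0} :=
    ⟨Ideal.Quotient.mk J g, fun h => hgJ (Ideal.Quotient.eq_zero_iff_mem.1 h),
      Ideal.Quotient.eq_zero_iff_mem.2 hg⟩
  rw [← biUnion_associatedPrimes_eq_zero_divisors] at hzd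
  obtain ⟨p, hp, hlp⟩ := Set.mem_iUnion₂.1 hzd
  exact hl (Set.mem_iUnion₂.2 ⟨tr p, Finset.mem_image_of_mem _ (hfin.mem_toFinset.2 hp), hlp⟩)

end MvPolynomial

/-! ### Saturation and hyperplane sections -/

namespace ProjSubscheme

variable {K : Type*} [Field K] {m : ℕ}

theorem le_satIdeal (X : ProjSubscheme K m) : X.toIdeal ≤ X.satIdeal :=
  fun f hf => ⟨0, fun i => by simpa using hf⟩

theorem mem_satIdeal_of_X_mul_mem (X : ProjSubscheme K m) {f : MvPolynomial (Fin (m + 1)) K}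
    (h : ∀ i, MvPolynomial.X i * f ∈ X.satIdeal) : f ∈ X.satIdeal := by
  choose n hn using h
  refine ⟨Finset.univ.sup n + 1, fun i => ?_⟩
  have hle : n i ≤ Finset.univ.sup n := Finset.le_sup (Finset.mem_univ i)
  have h1 := X.toIdeal.mul_mem_left (MvPolynomial.X i ^ (Finset.univ.sup n - n i)) (hn i i)
  convert h1 using 1
  rw [← mul_assoc, ← mul_assoc, ← pow_add, Nat.sub_add_cancel hle, pow_succ]

theorem isHomogeneous_satIdeal (X : ProjSubscheme K m) :
    X.satIdeal.IsHomogeneous (homogeneousSubmodule (Fin (m + 1)) K) := by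
  rintro j f ⟨n, hn⟩
  have hcomp : (DirectSum.decompose (homogeneousSubmodule (Fin (m + 1)) K) f j :
      MvPolynomial (Fin (m + 1)) K) = homogeneousComponent j f :=
    decomposition.decompose'_apply f j
  rw [hcomp]
  refine ⟨n, fun i => ?_⟩
  rw [← homogeneousComponent_mul_of_isHomogeneous (isHomogeneous_X_pow i n)]
  exact homogeneousComponent_mem_of_mem X.isHomogeneous (hn i) _

/-- An ideal and its saturation agree in large degrees: finitely many generators of the saturation
are multiplied into the ideal by all forms of large degree, so the saturation lies in the sum of the
ideal and of a space of polynomials of bounded degree. -/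
theorem exists_forall_mem_of_mem_satIdeal (X : ProjSubscheme K m) :
    ∃ T : ℕ, ∀ t, T < t → ∀ f : MvPolynomial (Fin (m + 1)) K, f.IsHomogeneous t →
      f ∈ X.satIdeal → f ∈ X.toIdeal := by
  classical
  obtain ⟨s, hs⟩ := IsNoetherian.noetherian X.satIdeal
  have hmem : ∀ g : s, (g : MvPolynomial (Fin (m + 1)) K) ∈ X.satIdeal := fun g =>
    hs ▸ Ideal.subset_span g.2
  choose n hn using hmem
  let D := (m + 1) * Finset.univ.sup n
  let T := D + s.sup totalDegree
  let M : Submodule K (MvPolynomial (Fin (m + 1)) K) :=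
    restrictTotalDegree (Fin (m + 1)) K T ⊔ X.toIdeal.restrictScalars K
  have hM : ∀ f ∈ X.satIdeal, f ∈ M := by
    intro f hf
    rw [← hs, Submodule.mem_span_finset'] at hf
    obtain ⟨a, rfl⟩ := hf
    refine Submodule.sum_mem _ fun g _ => ?_
    rw [smul_eq_mul, ← sum_homogeneousComponent (a g), Finset.sum_mul]
    refine Submodule.sum_mem _ fun j _ => ?_
    rcases le_or_gt j D with hj | hj
    · refine Submodule.mem_sup_left ?_
      rw [mem_restrictTotalDegree]
      exact (totalDegree_mul _ _).trans (add_le_add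
        ((homogeneousComponent_isHomogeneous j _).totalDegree_le.trans hj)
        (Finset.le_sup (f := totalDegree) g.2))
    · refine Submodule.mem_sup_right ?_
      refine mul_mem_of_X_pow_mul_mem (n := n g) (hn g) (lt_of_le_of_lt ?_ hj)
        (homogeneousComponent_isHomogeneous j _)
      rw [Fintype.card_fin]
      exact Nat.mul_le_mul_left _ (Finset.le_sup (Finset.mem_univ g))
  refine ⟨T, fun t ht f hft hf => ?_⟩
  obtain ⟨p, hp, q, hq, rfl⟩ := Submodule.mem_sup.1 (hM f hf)
  rw [mem_restrictTotalDegree] at hp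
  have := homogeneousComponent_eq_self hft
  rw [map_add, homogeneousComponent_eq_zero t p (by omega), zero_add] at this
  rw [← this]
  exact homogeneousComponent_mem_of_mem X.isHomogeneous hq t

theorem hilbertFun_eq_hilb (X : ProjSubscheme K m) (t : ℕ) :
    X.hilbertFun t = hilb X.satIdeal t := rfl

theorem hilbertFun_le_hilb (X : ProjSubscheme K m) (t : ℕ) :
    X.hilbertFun t ≤ hilb X.toIdeal t :=
  hilb_anti X.le_satIdeal t

theorem eventually_hilbertFun_eq_hilb (X : ProjSubscheme K m) :
    ∀ᶠ t in Filter.atTop, X.hilbertFun t = hilb X.toIdeal t := by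
  obtain ⟨T, hT⟩ := X.exists_forall_mem_of_mem_satIdeal
  filter_upwards [Filter.eventually_gt_atTop T] with t ht
  exact hilb_eq_of_forall_mem X.le_satIdeal t (hT t ht)

/-- A hyperplane section `Y` of `X`, cut out by a linear form that is a nonzerodivisor on `S(X)`.
The ideal of `Y` is `I(X) + (l)`, which need not be saturated; the Hilbert function of the quotient
by it is the first difference of that of `X`. -/
theorem exists_hyperplane_section [Infinite K] (X : ProjSubscheme K m) :
    ∃ Y : ProjSubscheme K m,
      (∀ t, hilb Y.toIdeal (t + 1) + X.hilbertFun t = X.hilbertFun (t + 1)) ∧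
      hilb Y.toIdeal 0 ≤ X.hilbertFun 0 ∧
      (X.satIdeal ≠ ⊤ → X.satIdeal < Y.toIdeal) := by
  obtain ⟨l, hl, hreg⟩ := exists_linear_form_regular X.satIdeal
    fun f => X.mem_satIdeal_of_X_mul_mem
  refine ⟨⟨X.satIdeal ⊔ Ideal.span {l}, Ideal.IsHomogeneous.sup X.isHomogeneous_satIdeal
    (Ideal.homogeneous_span _ _ ?_)⟩, fun t => ?_, ?_, fun hne => ?_⟩
  · rintro _ rfl
    exact ⟨1, hl⟩
  · exact hilb_sup_span_add X.isHomogeneous_satIdeal hl hreg t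
  · exact hilb_anti le_sup_left 0
  · refine lt_of_le_of_ne le_sup_left fun heq => hne ((Ideal.eq_top_iff_one _).2 (hreg 1 ?_))
    rw [mul_one, heq]
    exact Ideal.mem_sup_right (Ideal.mem_span_singleton_self l)

end ProjSubscheme

/-! ### Finite differences, polynomials and binomial coefficients -/

section

open Filter fwdDiff

/-- The sums of the values of a polynomial are polynomial, by Faulhaber's formula. -/
theorem exists_polynomial_sum_range_eq (Q : Polynomial ℚ) :
    ∃ P : Polynomial ℚ, ∀ n : ℕ, ∑ i ∈ Finset.range n, Q.eval (i : ℚ) = P.eval (n : ℚ) := by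
  induction Q using Polynomial.induction_on' with
  | add Q₁ Q₂ h₁ h₂ =>
    obtain ⟨P₁, h₁⟩ := h₁
    obtain ⟨P₂, h₂⟩ := h₂
    exact ⟨P₁ + P₂, fun n => by simp [Finset.sum_add_distrib, h₁, h₂]⟩
  | monomial p a =>
    refine ⟨Polynomial.C a * ∑ i ∈ Finset.range (p + 1),
      Polynomial.C (bernoulli i * (p + 1).choose i / (p + 1)) * Polynomial.X ^ (p + 1 - i),
      fun n => ?_⟩
    simp only [Polynomial.eval_monomial, ← Finset.mul_sum, sum_range_pow, Polynomial.eval_mul,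
      Polynomial.eval_C, Polynomial.eval_finsetSum, Polynomial.eval_pow, Polynomial.eval_X]
    congr 1
    exact Finset.sum_congr rfl fun i _ => by ring

theorem exists_polynomial_of_eventually_succ_eq {h : ℕ → ℚ} {Q : Polynomial ℚ}
    (hQ : ∀ᶠ t : ℕ in atTop, h (t + 1) = h t + Q.eval (t : ℚ)) :
    ∃ P : Polynomial ℚ, ∀ᶠ t : ℕ in atTop, h t = P.eval (t : ℚ) := by
  obtain ⟨P, hP⟩ := exists_polynomial_sum_range_eq Q
  obtain ⟨N, hN⟩ := eventually_atTop.1 hQ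
  refine ⟨P + Polynomial.C (h N - P.eval (N : ℚ)), eventually_atTop.2 ⟨N, fun t ht => ?_⟩⟩
  rw [Polynomial.eval_add, Polynomial.eval_C]
  induction t, ht using Nat.le_induction with
  | base => ring
  | succ t ht ih =>
    rw [hN t ht, ih, ← hP (t + 1), Finset.sum_range_succ, hP t]
    ring

theorem fwdDiff_iter_eventually_congr {f g : ℕ → ℚ} (h : ∀ᶠ t in atTop, f t = g t) (n : ℕ) :
    ∀ᶠ t in atTop, (Δ_[1])^[n] f t = (Δ_[1])^[n] g t := by
  obtain ⟨N, hN⟩ := eventually_atTop.1 h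
  filter_upwards [eventually_ge_atTop N] with t ht
  simp_rw [fwdDiff_iter_eq_sum_shift]
  exact Finset.sum_congr rfl fun k _ => by rw [hN _ (by simp; omega)]

theorem fwdDiff_iter_natCast (f : ℚ → ℚ) (n t : ℕ) :
    (Δ_[1])^[n] (fun s : ℕ => f s) t = (Δ_[1])^[n] f (t : ℚ) := by
  simp [fwdDiff_iter_eq_sum_shift]

/-- A polynomial that is at least `(s + k).choose k` at the multiples `N * s` has degree at least
`k`. -/
theorem le_natDegree_of_choose_le {P : Polynomial ℚ} {k N : ℕ} (hN : 0 < N)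
    (h : ∀ᶠ s : ℕ in Filter.atTop, ((s + k).choose k : ℚ) ≤ P.eval ((N * s : ℕ) : ℚ)) :
    k ≤ P.natDegree := by
  by_contra! hlt
  have hdeg : P.degree < (Polynomial.X ^ k : Polynomial ℚ).degree := by
    rw [Polynomial.degree_X_pow]
    exact Polynomial.degree_le_natDegree.trans_lt (by exact_mod_cast hlt)
  have hlim := Polynomial.div_tendsto_atTop_zero_of_degree_lt P (Polynomial.X ^ k) hdeg
  have hNs : Filter.Tendsto (fun s : ℕ => ((N * s : ℕ) : ℚ)) Filter.atTop Filter.atTop :=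
    tendsto_natCast_atTop_atTop.comp (Filter.tendsto_id.const_mul_atTop' hN)
  have hε : (0 : ℚ) < 1 / (k.factorial * N ^ k) := by positivity
  obtain ⟨s, hs1, hs2, hs3⟩ := (((hlim.comp hNs).eventually (gt_mem_nhds hε)).and
    (h.and (Filter.eventually_gt_atTop 0))).exists
  have hs : (0 : ℚ) < s := by exact_mod_cast hs3
  have hNq : (0 : ℚ) < N := by exact_mod_cast hN
  have hchoose : (s : ℚ) ^ k ≤ k.factorial * (s + k).choose k := by
    have : s ^ k ≤ k.factorial * (s + k).choose k := by
      refine le_trans (Nat.pow_le_pow_left ?_ k) (Nat.pow_sub_le_descFactorial (s + k) k |>.trans_eq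
        (Nat.descFactorial_eq_factorial_mul_choose _ _))
      omega
    exact_mod_cast this
  simp only [Function.comp_apply, Polynomial.eval_pow, Polynomial.eval_X] at hs1
  rw [div_lt_div_iff₀ (by positivity) (by positivity)] at hs1
  have hf : (0 : ℚ) < k.factorial := by exact_mod_cast k.factorial_pos
  have : (s : ℚ) ^ k * N ^ k ≤ k.factorial * P.eval ((N * s : ℕ) : ℚ) * N ^ k := by
    gcongr
    exact hchoose.trans (by gcongr)
  push_cast at *
  rw [mul_pow] at hs1
  linarith

/-- The Hilbert function of a hypersurface of degree `c` in `ℙ^(k + 1)` is monotone in `k`. -/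
theorem choose_add_choose_sub_le (c t k d : ℕ) (hkd : k ≤ d) :
    (t + k + 1).choose (k + 1) + (t + d + 1 - c).choose (d + 1) ≤
      (t + d + 1).choose (d + 1) + (t + k + 1 - c).choose (k + 1) := by
  induction d, hkd using Nat.le_induction with
  | base => exact le_rfl
  | succ d _ ih =>
    have h1 : (t + (d + 1) + 1).choose (d + 1 + 1) =
        (t + d + 1).choose (d + 1) + (t + d + 1).choose (d + 1 + 1) := Nat.choose_succ_succ' _ _
    have h2 : (t + (d + 1) + 1 - c).choose (d + 1 + 1) ≤
        (t + d + 1 - c).choose (d + 1) + (t + d + 1).choose (d + 1 + 1) := by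
      rcases le_or_gt c (t + d + 1) with hc | hc
      · rw [show t + (d + 1) + 1 - c = (t + d + 1 - c) + 1 by omega, Nat.choose_succ_succ']
        exact Nat.add_le_add_left (Nat.choose_le_choose _ (Nat.sub_le _ _)) _
      · rw [Nat.choose_eq_zero_of_lt (by omega)]
        exact Nat.zero_le _
    omega

end

/-! ### Hilbert polynomials and the lower bound by induction -/

namespace ProjSubscheme

open Filter fwdDiff

variable {K : Type*} [Field K] {m : ℕ}

/-- Noetherian induction on the saturated ideal: passing to a hyperplane section enlarges it and
takes the first difference of the Hilbert function. -/
theorem exists_isHilbertPolynomial [Infinite K] (X : ProjSubscheme K m) :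
    ∃ P : Polynomial ℚ, X.IsHilbertPolynomial P := by
  induction hI : X.satIdeal using IsNoetherian.induction generalizing X with
  | hgt I ih =>
    subst hI
    by_cases htop : X.satIdeal = ⊤
    · refine ⟨0, Eventually.of_forall fun t => ?_⟩
      rw [hilbertFun_eq_hilb, hilb_eq_zero_iff.2 fun f _ => htop ▸ Submodule.mem_top]
      simp
    · obtain ⟨Y, hY, -, hlt⟩ := X.exists_hyperplane_section
      obtain ⟨Q, hQ⟩ := ih _ ((hlt htop).trans_le Y.le_satIdeal) Y rfl
      refine exists_polynomial_of_eventually_succ_eq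
        (Q := Q.comp (Polynomial.X + 1)) ?_
      filter_upwards [(tendsto_add_atTop_nat 1).eventually Y.eventually_hilbertFun_eq_hilb,
        (tendsto_add_atTop_nat 1).eventually hQ] with t h1 h2
      rw [← hY t, ← h1, Nat.cast_add, h2]
      simp [add_comm]

/-- The bound for a Hilbert function that is eventually constant with value `c`. Its first
difference is the Hilbert function of a standard graded algebra, so it stays zero once it vanishes:
the Hilbert function grows by at least one in each step until it reaches `c`. -/
theorem succ_le_hilbertFun_add_of_eventually_eq [Infinite K] (X : ProjSubscheme K m) (c : ℕ)
    (hX : ∀ᶠ t in atTop, X.hilbertFun t = c) (t : ℕ) :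
    t + 1 ≤ X.hilbertFun t + (t + 1 - c) := by
  obtain ⟨Y, hY, hY0, -⟩ := X.exists_hyperplane_section
  by_cases h : ∃ s ≤ t, hilb Y.toIdeal s = 0
  · obtain ⟨s, hst, hs⟩ := h
    have hconst : ∀ u, t ≤ u → X.hilbertFun u = X.hilbertFun t := by
      intro u hu
      induction u, hu using Nat.le_induction with
      | base => rfl
      | succ u hu ih =>
        rw [← ih, ← hY u, hilb_eq_zero_of_le hs (by omega), zero_add]
    obtain ⟨u, hu, hut⟩ := (hX.and (eventually_ge_atTop t)).exists
    rw [← hconst u hut, hu]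
    omega
  · push Not at h
    have hgrow : ∀ s ≤ t, s + 1 ≤ X.hilbertFun s := by
      intro s
      induction s with
      | zero => exact fun h0 => (Nat.one_le_iff_ne_zero.2 (h 0 h0)).trans hY0
      | succ s ih =>
        intro hs
        have h1 := ih (by omega)
        have h2 := h (s + 1) hs
        have h3 := hY s
        omega
    exact (hgrow t le_rfl).trans (Nat.le_add_right _ _)

/-- If the `d`-th difference of the Hilbert function is eventually `c`, then the Hilbert function is
at least that of a hypersurface of degree `c` in `ℙ^(d + 1)`. The subtraction `t + d + 1 - c` is
truncated: the last binomial coefficient vanishes for `t < c`, so that both ranges of `t` are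
covered. -/
theorem choose_le_hilbertFun_add [Infinite K] (c d : ℕ) (X : ProjSubscheme K m)
    (hX : ∀ᶠ t in atTop, (Δ_[1])^[d] (fun s => (X.hilbertFun s : ℚ)) t = c) (t : ℕ) :
    (t + d + 1).choose (d + 1) ≤ X.hilbertFun t + (t + d + 1 - c).choose (d + 1) := by
  induction d generalizing X t with
  | zero =>
    simpa using X.succ_le_hilbertFun_add_of_eventually_eq c (by simpa using hX) t
  | succ d ih =>
    obtain ⟨Y, hY, hY0, -⟩ := X.exists_hyperplane_section
    have hYX : ∀ᶠ t in atTop, (Y.hilbertFun (t + 1) : ℚ) =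
        Δ_[1] (fun s => (X.hilbertFun s : ℚ)) t := by
      filter_upwards [(tendsto_add_atTop_nat 1).eventually Y.eventually_hilbertFun_eq_hilb]
        with t ht
      rw [ht, fwdDiff, ← hY t]
      push_cast
      ring
    have hYc : ∀ᶠ t in atTop, (Δ_[1])^[d] (fun s => (Y.hilbertFun s : ℚ)) t = c := by
      rw [← map_add_atTop_eq_nat 1, eventually_map]
      filter_upwards [hX, fwdDiff_iter_eventually_congr hYX d] with t h1 h2
      rw [← fwdDiff_iter_comp_add, h2, ← h1, Function.iterate_succ_apply]
    -- Sum the bound for `Y` over the degrees up to `t`; Pascal's rule gives the bound for `X`.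
    induction t with
    | zero =>
      have h1 := ih Y hYc 0
      have h2 := Y.hilbertFun_le_hilb 0
      rcases Nat.eq_zero_or_pos c with rfl | hc
      · simp
      · rw [Nat.choose_eq_zero_of_lt (show 0 + d + 1 - c < d + 1 by omega)] at h1
        simp only [zero_add, Nat.choose_self] at h1 ⊢
        omega
    | succ t iht =>
      have h1 := ih Y hYc (t + 1)
      have h2 := Y.hilbertFun_le_hilb (t + 1)
      have h3 := hY t
      have h4 : (t + 1 + (d + 1) + 1).choose (d + 1 + 1) =
          (t + 1 + d + 1).choose (d + 1) + (t + (d + 1) + 1).choose (d + 1 + 1) := by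
        rw [show t + 1 + d + 1 = t + (d + 1) + 1 by ring,
          show t + 1 + (d + 1) + 1 = t + (d + 1) + 1 + 1 by ring, Nat.choose_succ_succ']
      have h5 : (t + 1 + d + 1 - c).choose (d + 1) + (t + (d + 1) + 1 - c).choose (d + 1 + 1) ≤
          (t + 1 + (d + 1) + 1 - c).choose (d + 1 + 1) := by
        -- Pascal's rule fails for `c > t + d + 2`, where the subtractions are truncated to `0`;
        -- there the left-hand side vanishes because the lower indices are positive.
        rcases le_or_gt c (t + d + 2) with hc | hc
        · rw [show t + 1 + (d + 1) + 1 - c = (t + (d + 1) + 1 - c) + 1 by omega,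
            show t + 1 + d + 1 - c = t + (d + 1) + 1 - c by omega, Nat.choose_succ_succ']
        · rw [show t + 1 + d + 1 - c = 0 by omega, show t + (d + 1) + 1 - c = 0 by omega]
          simp
      omega

end ProjSubscheme

/-! ### Growth of the Hilbert function -/

namespace MvPolynomial

variable {σ K : Type*} [Field K] [Finite σ]

/-- Along the multiples of some `N > 0`, the Hilbert function of `K[x] / J` is at least that of a
polynomial ring in `j + 1` variables; in particular it grows at least like `t ^ j`. -/
def HasGrowth (J : Ideal (MvPolynomial σ K)) (j : ℕ) : Prop :=
  ∃ N : ℕ, 0 < N ∧ ∀ s, (s + j).choose j ≤ hilb J (N * s)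

/-- The growth order rises when passing from `J'` to a smaller ideal `J` for which `J'` contains a
form `f` that is a nonzerodivisor modulo `J`. If `J'` grows along the multiples of `N`, then `J`
grows along those of `e * N`, the degree of `f ^ N`: the increment of the Hilbert function of `J`
over a step of that length is the Hilbert function of `J + (f ^ N)`, hence at least that of `J'`. -/
theorem HasGrowth.succ {J J' : Ideal (MvPolynomial σ K)} {j : ℕ} (h : HasGrowth J' j)
    (hJ : J.IsHomogeneous (homogeneousSubmodule σ K)) (hle : J ≤ J') {f : MvPolynomial σ K} {e : ℕ}
    (hf : f.IsHomogeneous e) (hfJ' : f ∈ J') (hreg : ∀ g, f * g ∈ J → g ∈ J) :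
    HasGrowth J (j + 1) := by
  obtain ⟨N, hN, hs⟩ := h
  have hpow : ∀ n g, f ^ n * g ∈ J → g ∈ J := by
    intro n
    induction n with
    | zero => simp
    | succ n ih => exact fun g hg => hreg g (ih _ (by rwa [← mul_assoc, ← pow_succ]))
  have hsup : J ⊔ Ideal.span {f ^ N} ≤ J' :=
    sup_le hle ((Ideal.span_singleton_le_iff_mem _).2 (Ideal.pow_mem_of_mem _ hfJ' N hN))
  have hstep : ∀ t, hilb J' (t + e * N) + hilb J t ≤ hilb J (t + e * N) := fun t => by
    rw [← hilb_sup_span_add hJ (hf.pow N) (hpow N) t]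
    exact Nat.add_le_add_right (hilb_anti hsup _) _
  have h0 : 1 ≤ hilb J' 0 := by simpa using hs 0
  -- For `e = 0` the exact sequence in degree `0` would force `hilb J' 0 = 0`.
  have he : 0 < e := by
    rcases Nat.eq_zero_or_pos e with rfl | he
    · have := hstep 0
      rw [zero_mul, add_zero] at this
      omega
    · exact he
  refine ⟨e * N, Nat.mul_pos he hN, fun s => ?_⟩
  induction s with
  | zero => simpa using h0.trans (hilb_anti hle 0)
  | succ s ih =>
    have h1 := hstep (e * N * s)
    have h2 := hs (e * (s + 1))
    have h3 : (s + 1 + j).choose j ≤ (e * (s + 1) + j).choose j :=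
      Nat.choose_le_choose _ (Nat.add_le_add_right (Nat.le_mul_of_pos_left _ he) _)
    have h4 : (s + 1 + (j + 1)).choose (j + 1) =
        (s + 1 + j).choose j + (s + (j + 1)).choose (j + 1) := by
      rw [show s + (j + 1) = s + 1 + j by ring]
      exact Nat.choose_succ_succ' _ _
    rw [show N * (e * (s + 1)) = e * N * s + e * N by ring] at h2
    rw [show e * N * (s + 1) = e * N * s + e * N by ring]
    omega

end MvPolynomial

/-! ### Homogeneous primes of irreducible closed sets -/

namespace MvPolynomial

variable {σ K : Type*} [Field K]

/-- A relevant homogeneous prime omits some variable. -/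
theorem exists_X_notMem (z : ProjectiveSpectrum (homogeneousSubmodule σ K)) :
    ∃ i, (X i : MvPolynomial σ K) ∉ z.asHomogeneousIdeal.toIdeal := by
  by_contra! h
  refine z.not_irrelevant_le fun f hf => ?_
  have hle : Ideal.span (X '' Set.univ) ≤ z.asHomogeneousIdeal.toIdeal := by
    rw [Ideal.span_le]
    rintro _ ⟨i, _, rfl⟩
    exact h i
  refine hle (mem_ideal_span_X_image.2 fun d hd => ?_)
  have h0 : coeff 0 f = 0 := by
    have hf' := (HomogeneousIdeal.mem_irrelevant_iff _ _).1 hf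
    have h1 : homogeneousComponent 0 f = 0 := (decomposition.decompose'_apply f 0).symm.trans hf'
    simpa [homogeneousComponent_zero] using h1
  by_contra! hall
  refine mem_support_iff.1 hd ?_
  rw [show d = 0 from Finsupp.ext fun i => hall i trivial, h0]

theorem isPrime_vanishingIdeal {Z : Set (ProjectiveSpectrum (homogeneousSubmodule σ K))}
    (hZ : IsIrreducible Z) : (ProjectiveSpectrum.vanishingIdeal Z).toIdeal.IsPrime := by
  have hmem : ∀ f, f ∈ (ProjectiveSpectrum.vanishingIdeal Z).toIdeal ↔
      ∀ z ∈ Z, f ∈ z.asHomogeneousIdeal :=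
    fun f => ProjectiveSpectrum.mem_vanishingIdeal Z f
  refine Ideal.IsPrime.mk (fun htop => ?_) fun {f g} hfg => ?_
  · obtain ⟨z, hz⟩ := hZ.nonempty
    exact z.isPrime.ne_top ((Ideal.eq_top_iff_one _).2
      ((hmem 1).1 (htop ▸ Submodule.mem_top) z hz))
  · have hcover : Z ⊆ ProjectiveSpectrum.zeroLocus _ {f} ∪ ProjectiveSpectrum.zeroLocus _ {g} := by
      intro z hz
      simp only [Set.mem_union, ProjectiveSpectrum.mem_zeroLocus, Set.singleton_subset_iff]
      exact z.isPrime.mem_or_mem ((hmem _).1 hfg z hz)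
    rw [hmem, hmem]
    refine ((isPreirreducible_iff_isClosed_union_isClosed.1 hZ.isPreirreducible _ _
      (ProjectiveSpectrum.isClosed_zeroLocus _ _)
      (ProjectiveSpectrum.isClosed_zeroLocus _ _) hcover).imp ?_ ?_) <;>
    exact fun h z hz => Set.singleton_subset_iff.1 (h hz)

variable [Finite σ]

theorem hasGrowth_zero_vanishingIdeal {Z : Set (ProjectiveSpectrum (homogeneousSubmodule σ K))}
    (hZ : Z.Nonempty) : HasGrowth (ProjectiveSpectrum.vanishingIdeal Z).toIdeal 0 := by
  obtain ⟨z, hz⟩ := hZ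
  obtain ⟨i, hi⟩ := exists_X_notMem z
  refine ⟨1, one_pos, fun s => ?_⟩
  rw [Nat.choose_zero_right, Nat.one_le_iff_ne_zero, Ne, hilb_eq_zero_iff]
  intro h
  have h1 := h _ (isHomogeneous_X_pow i (1 * s))
  exact hi (z.isPrime.mem_of_pow_mem _ ((ProjectiveSpectrum.mem_vanishingIdeal Z _).1 h1 z hz))

theorem HasGrowth.succ_vanishingIdeal {Z Z' : Set (ProjectiveSpectrum (homogeneousSubmodule σ K))}
    {j : ℕ} (h : HasGrowth (ProjectiveSpectrum.vanishingIdeal Z).toIdeal j) (hZ : IsClosed Z)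
    (hZ' : IsIrreducible Z') (hlt : Z ⊂ Z') :
    HasGrowth (ProjectiveSpectrum.vanishingIdeal Z').toIdeal (j + 1) := by
  have hle := ProjectiveSpectrum.vanishingIdeal_anti_mono _ hlt.subset
  obtain ⟨f, hfZ, hfZ'⟩ : ∃ f, f ∈ (ProjectiveSpectrum.vanishingIdeal Z).toIdeal ∧
      f ∉ (ProjectiveSpectrum.vanishingIdeal Z').toIdeal := by
    by_contra! hall
    refine hlt.not_subset ?_
    rw [← hZ.closure_eq, ← ProjectiveSpectrum.zeroLocus_vanishingIdeal_eq_closure,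
      ProjectiveSpectrum.subset_zeroLocus_iff_subset_vanishingIdeal]
    exact hall
  rw [mem_iff_homogeneousComponent_mem (ProjectiveSpectrum.vanishingIdeal Z').isHomogeneous] at hfZ'
  push Not at hfZ'
  obtain ⟨e, he⟩ := hfZ'
  exact h.succ (ProjectiveSpectrum.vanishingIdeal Z').isHomogeneous hle
    (homogeneousComponent_isHomogeneous e f)
    (homogeneousComponent_mem_of_mem (ProjectiveSpectrum.vanishingIdeal Z).isHomogeneous hfZ e)
    fun g hg => ((isPrime_vanishingIdeal hZ').mem_or_mem hg).resolve_left he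

end MvPolynomial

/-! ### Dimension and degree -/

namespace ProjSubscheme

variable {K : Type*} [Field K] {m : ℕ}

theorem satIdeal_le_vanishingIdeal (X : ProjSubscheme K m)
    {Z : Set (ProjectiveSpectrum (homogeneousSubmodule (Fin (m + 1)) K))} (hZ : Z ⊆ X.support) :
    X.satIdeal ≤ (ProjectiveSpectrum.vanishingIdeal Z).toIdeal := by
  rintro f ⟨n, hn⟩
  refine (ProjectiveSpectrum.mem_vanishingIdeal Z f).2 fun z hz => ?_
  obtain ⟨i, hi⟩ := exists_X_notMem z
  exact (z.isPrime.mem_or_mem (hZ hz (hn i))).resolve_left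
    fun h => hi (z.isPrime.mem_of_pow_mem _ h)

/-- A chain of `k + 1` irreducible closed subsets of `X` gives a chain of relevant homogeneous
primes containing `I(X)`, and the growth order rises by one with each step down the chain of primes.
-/
theorem hasGrowth_of_le_dim (X : ProjSubscheme K m) {k : ℕ} (hk : (k : WithBot ℕ∞) ≤ X.dim) :
    HasGrowth X.satIdeal k := by
  obtain ⟨l, hl⟩ := Order.le_krullDim_iff.1 hk
  let Z : Fin (l.length + 1) → Set (ProjectiveSpectrum (homogeneousSubmodule (Fin (m + 1)) K)) :=
    fun i => Subtype.val '' (l i : Set X.support)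
  have hirr : ∀ i, IsIrreducible (Z i) := fun i =>
    (l i).isIrreducible.image _ continuous_subtype_val.continuousOn
  have hclosed : ∀ i, IsClosed (Z i) := fun i =>
    ((ProjectiveSpectrum.isClosed_zeroLocus _ _).isClosedEmbedding_subtypeVal.isClosedMap)
      _ (l i).isClosed
  have hgrow : ∀ i : Fin (l.length + 1),
      HasGrowth (ProjectiveSpectrum.vanishingIdeal (Z i)).toIdeal i := by
    intro i
    induction i using Fin.induction with
    | zero => exact hasGrowth_zero_vanishingIdeal (hirr 0).nonempty
    | succ i ih =>
      refine ih.succ_vanishingIdeal (hclosed _) (hirr _) ?_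
      exact Subtype.val_injective.image_strictMono (l.step i)
  obtain ⟨N, hN, h⟩ := hgrow (Fin.last _)
  refine ⟨N, hN, fun s => ?_⟩
  rw [← hl]
  exact (h s).trans
    (hilb_anti (X.satIdeal_le_vanishingIdeal (by rintro _ ⟨z, _, rfl⟩; exact z.2)) _)

/-- The dimension of `X` is at most the degree of its Hilbert polynomial. -/
theorem IsHilbertPolynomial.le_natDegree {X : ProjSubscheme K m} {P : Polynomial ℚ}
    (hP : X.IsHilbertPolynomial P) {k : ℕ} (hk : (k : WithBot ℕ∞) ≤ X.dim) : k ≤ P.natDegree := by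
  obtain ⟨N, hN, h⟩ := X.hasGrowth_of_le_dim hk
  refine le_natDegree_of_choose_le hN ?_
  filter_upwards [(Filter.tendsto_id.const_mul_atTop' hN).eventually hP] with s hs
  rw [id] at hs
  rw [← hs]
  exact_mod_cast h s

open Filter fwdDiff in
theorem IsHilbertPolynomial.eventually_fwdDiff_iter_eq {X : ProjSubscheme K m} {P : Polynomial ℚ}
    (hP : X.IsHilbertPolynomial P) :
    ∀ᶠ t in atTop, (Δ_[1])^[P.natDegree] (fun s => (X.hilbertFun s : ℚ)) t = X.deg := by
  filter_upwards [fwdDiff_iter_eventually_congr hP P.natDegree] with t ht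
  rw [ht, fwdDiff_iter_natCast P.eval, Polynomial.fwdDiff_iter_degree_eq_factorial, deg, hP.eq]
  simp [mul_comm]

theorem choose_le_hilbertFun_add_of_deg_eq [Infinite K] (X : ProjSubscheme K m) {k c : ℕ}
    (hdim : X.dim = k) (hdeg : X.deg = c) (t : ℕ) :
    (t + k + 1).choose (k + 1) ≤ X.hilbertFun t + (t + k + 1 - c).choose (k + 1) := by
  obtain ⟨P, hP⟩ := X.exists_isHilbertPolynomial
  have h1 := choose_le_hilbertFun_add c _ X (hdeg ▸ hP.eventually_fwdDiff_iter_eq) t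
  -- The degree of `P` is `dim X`, but `dim X ≤ deg P` suffices, as the bound is monotone in `k`.
  have h2 := choose_add_choose_sub_le c t k _ (hP.le_natDegree hdim.ge)
  omega

end ProjSubscheme

end

theorem proposition2p2 {F : Type*} [Field F] [Finite F]
    {K : Type*} [Field K] [Algebra F K] [IsAlgClosure F K]
    (m : ℕ) (X : ProjSubscheme K m) (k c : ℕ) (hdim : X.dim = k) (hdeg : X.deg = c) :
    (∀ t : ℕ, (t : ℤ) ≤ (c : ℤ) - 1 →
      (t + k + 1).choose (k + 1) ≤ Module.finrank K (X.coordPart t)) ∧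
    (∀ t : ℕ, c ≤ t →
      ((t + k + 1).choose (k + 1) : ℤ) - ((t + k + 1 - c).choose (k + 1) : ℤ) ≤
        (Module.finrank K (X.coordPart t) : ℤ)) := by
  have : IsAlgClosed K := IsAlgClosure.isAlgClosed F
  have : Infinite K := IsAlgClosed.instInfinite
  have key : ∀ t, (t + k + 1).choose (k + 1) ≤
      Module.finrank K (X.coordPart t) + (t + k + 1 - c).choose (k + 1) :=
    X.choose_le_hilbertFun_add_of_deg_eq hdim hdeg
  refine ⟨fun t ht => ?_, fun t _ => ?_⟩
  -- For `t < c` the subtraction `t + k + 1 - c` drops below `k + 1`, so the binomial is zero.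
  · have h := key t
    rwa [Nat.choose_eq_zero_of_lt (show t + k + 1 - c < k + 1 by omega), add_zero] at h
  · have h := key t
    omega
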